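/- Let $G$ be a compact (Hausdorff) group, let $\mathcal A$ be a unital C$^*$-algebra, and let $(\mathcal A,G,\alpha)$ be a C$^*$-dynamical system, i.e. $\alpha$ is an action of $G$ on $\mathcal A$ by $^*$-automorphisms such that $g\mapsto\alpha_g(x)$ is continuous for every $x\in\mathcal A$. Let $\mathcal B=\mathcal A^G$ be its fixed point algebra. Representations of $G$ are finite-dimensional, continuous and unitary; $\hat G$ is the set of equivalence classes of irreducible ones, and we fix a representative $(\pi,V_\pi)$ of each class. For a representation $(\pi,V)$ put $$A_2(\pi)=\{x\in\mathcal A\otimes\mathrm{End}(V)\;:\;(1\otimes\pi_g)\,(\alpha_g\otimes\mathrm{id})(x)=x\ \text{ for all } g\in G\}.$$ The system is called cleft if $A_2(\pi)$ contains a unitary element for every irreducible $\pi$. A non-degenerate isometry in $A_2(\pi)$ is an element $s\in A_2(\pi)$ with $s^*s=1$ and $ss^*x=x$ for all $x\in A_2(\pi)$. Let $(s_\pi)_{\pi\in\hat G}$ be a family of non-degenerate isometries $s_\pi\in A_2(\pi)$ with $s_1=1$ for the trivial representation $1$. For an arbitrary representation $\tau$ put $s_\tau=\sum_k v_k s_{\sigma_k}v_k^*$,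 where $\tau$ is decomposed into irreducible representations $\sigma_k\in\hat G$ by isometric intertwiners $v_k:V_{\sigma_k}\to V_\tau$ with $\sum_k v_kv_k^*=1$ (the result does not depend on the decomposition). The factor system associated with $(s_\pi)$ is the pair $(\gamma,\omega)$ of families $$\gamma_\pi:\mathcal B\to\mathcal B\otimes\mathrm{End}(V_\pi),\quad \gamma_\pi(b)=s_\pi^*(b\otimes1)s_\pi,\qquad \omega(\pi,\rho)=s_{\pi\otimes\rho}^*\,(s_\pi)_{12}\,(s_\rho)_{13}\in\mathcal B\otimes\mathrm{End}(V_\pi)\otimes\mathrm{End}(V_\rho)$$ for $\pi,\rho\in\hat G$, where $x_{12}$ and $y_{13}$ denote the canonical images in $\mathcal A\otimes\mathrm{End}(V_\pi)\otimes\mathrm{End}(V_\rho)$ of $x\in\mathcal A\otimes\mathrm{End}(V_\pi)$ and $y\in\mathcal A\otimes\mathrm{End}(V_\rho)$. **Corollary.** Suppose that $(\mathcal A,G,\alpha)$ is cleft and that $\mathcal B$ is commutative, and let $(\gamma,\omega)$ be the factor system associated with an arbitrary family $(s_\pi)_{\pi\in\hat G}$ as above. Then $\mathcal A$ is commutative if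 and only if $$\gamma_\pi(b)=b\otimes 1\qquad\text{and}\qquad \omega(\rho,\pi)=\sigma\bigl(\omega(\pi,\rho)\bigr)$$ for all $\pi,\rho\in\hat G$ and $b\in\mathcal B$, where $\sigma:\mathcal B\otimes\mathrm{End}(V_\pi)\otimes\mathrm{End}(V_\rho)\to\mathcal B\otimes\mathrm{End}(V_\rho)\otimes\mathrm{End}(V_\pi)$ is the tensor flip of the last two factors. -/

import Mathlib

open scoped Matrix Kronecker

noncomputable section

namespace CleftSystem

/-! ### Representations of a topological group

A representation is a finite-dimensional unitary one, written in an orthonormal basis indexed by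
`ι`. Accordingly `End(V)` is `Matrix ι ι ℂ`, and for a C⋆-algebra `A` the (minimal) tensor product
`A ⊗ End(V)` is the ⋆-algebra `Matrix ι ι A`. -/

section Representations

variable (G : Type*) [Group G] [TopologicalSpace G]

/-- A continuous unitary representation of `G` on `ℂ^ι`. -/
abbrev URep (ι : Type) [Fintype ι] [DecidableEq ι] : Type _ :=
  G →ₜ* Matrix.unitaryGroup ι ℂ

variable {G}
variable {ι κ : Type} [Fintype ι] [DecidableEq ι] [Fintype κ] [DecidableEq κ]

/-- The matrix of `π_g`. -/
def URep.mat (π : URep G ι) (g : G) : Matrix ι ι ℂ := (π g : Matrix ι ι ℂ)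

/-- The underlying linear representation. -/
def URep.toRep (π : URep G ι) : Representation ℂ G (ι → ℂ) where
  toFun g := Matrix.toLin' (π.mat g)
  map_one' := by simp [URep.mat, Module.End.one_eq_id]
  map_mul' g h := by simp [URep.mat, Matrix.toLin'_mul, Module.End.mul_eq_comp]

/-- `v : V_π → V_ρ` intertwines `π` and `ρ`. -/
def Intertwines (π : URep G ι) (ρ : URep G κ) (v : Matrix κ ι ℂ) : Prop :=
  ∀ g, v * π.mat g = ρ.mat g * v

/-- The tensor product `π ⊗ ρ` on `ℂ^ι ⊗ ℂ^κ = ℂ^(ι × κ)`. -/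
def URep.tensor (π : URep G ι) (ρ : URep G κ) : URep G (ι × κ) where
  toFun g := ⟨π.mat g ⊗ₖ ρ.mat g, Matrix.kronecker_mem_unitary (π g).2 (ρ g).2⟩
  map_one' := Subtype.ext (by simp [URep.mat])
  map_mul' g h := Subtype.ext (by simp [URep.mat, Matrix.mul_kronecker_mul])
  continuous_toFun := by
    have hπ : Continuous fun g => (π g : Matrix ι ι ℂ) :=
      continuous_subtype_val.comp π.continuous_toFun
    have hρ : Continuous fun g => (ρ g : Matrix κ κ ℂ) :=
      continuous_subtype_val.comp ρ.continuous_toFun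
    refine Continuous.subtype_mk (continuous_matrix fun i j => ?_) _
    exact (hπ.matrix_elem i.1 j.1).mul (hρ.matrix_elem i.2 j.2)

variable (G)

/-- An irreducible unitary representation of `G`. -/
structure Irrep where
  /-- the dimension `d_π` -/
  dim : ℕ
  /-- the representation -/
  rep : URep G (Fin dim)
  irreducible : rep.toRep.IsIrreducible

/-- Unitary equivalence of irreducible representations. -/
def Irrep.Equivalent (π ρ : Irrep G) : Prop :=
  ∃ v : Matrix (Fin ρ.dim) (Fin π.dim) ℂ,
    vᴴ * v = 1 ∧ v * vᴴ = 1 ∧ Intertwines π.rep ρ.rep v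

instance irrepSetoid : Setoid (Irrep G) where
  r := Irrep.Equivalent G
  iseqv :=
    { refl := fun π => ⟨1, by simp, by simp, fun g => by simp⟩
      symm := by
        rintro π ρ ⟨v, h1, h2, h3⟩
        refine ⟨vᴴ, by simpa using h2, by simpa using h1, fun g => ?_⟩
        calc vᴴ * ρ.rep.mat g = vᴴ * (ρ.rep.mat g * v) * vᴴ := by
              simp only [Matrix.mul_assoc, h2, Matrix.mul_one]
          _ = vᴴ * (v * π.rep.mat g) * vᴴ := by rw [h3 g]
          _ = π.rep.mat g * vᴴ := by
              rw [← Matrix.mul_assoc vᴴ v, h1, Matrix.one_mul]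
      trans := by
        rintro π ρ σ ⟨v, h1, h2, h3⟩ ⟨w, k1, k2, k3⟩
        refine ⟨w * v, ?_, ?_, fun g => ?_⟩
        · rw [Matrix.conjTranspose_mul, Matrix.mul_assoc, ← Matrix.mul_assoc wᴴ, k1,
            Matrix.one_mul, h1]
        · rw [Matrix.conjTranspose_mul, Matrix.mul_assoc, ← Matrix.mul_assoc v, h2,
            Matrix.one_mul, k2]
        · rw [Matrix.mul_assoc, h3 g, ← Matrix.mul_assoc, k3 g, Matrix.mul_assoc] }

/-- `Ĝ`, the set of equivalence classes of irreducible representations of `G`. -/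
def Dual : Type _ := Quotient (irrepSetoid G)

/-- A choice of a representative in each class in `Ĝ`. -/
structure Representatives where
  /-- the representative of a class -/
  irrep : Dual G → Irrep G
  spec : ∀ p, (Quotient.mk (irrepSetoid G) (irrep p) : Dual G) = p

variable {G}

/-- The dimension of the class `p`. -/
abbrev Representatives.dim (R : Representatives G) (p : Dual G) : ℕ := (R.irrep p).dim

/-- The representation representing the class `p`. -/
abbrev Representatives.rep (R : Representatives G) (p : Dual G) : URep G (Fin (R.dim p)) :=
  (R.irrep p).rep

/-- A decomposition of a representation `τ` into irreducible ones: isometric intertwiners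
`v_k : V_{σ_k} → V_τ` whose range projections add up to `1` (and so are orthogonal). -/
structure Decomposition (R : Representatives G) (τ : URep G ι) where
  /-- the number of summands -/
  len : ℕ
  /-- the classes of the summands -/
  comp : Fin len → Dual G
  /-- the intertwiners -/
  v : ∀ k, Matrix ι (Fin (R.dim (comp k))) ℂ
  intertwines : ∀ k, Intertwines (R.rep (comp k)) τ (v k)
  isometry : ∀ k, (v k)ᴴ * v k = 1
  complete : ∑ k, v k * (v k)ᴴ = 1

end Representations

/-! ### C⋆-dynamical systems -/

/-- The scalar matrix `m`, as a map between the free modules `A ⊗ ℂ^κ` and `A ⊗ ℂ^ι`. -/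
def scal (A : Type*) [CStarAlgebra A] {ι κ : Type} (m : Matrix ι κ ℂ) : Matrix ι κ A :=
  m.map (algebraMap ℂ A)

/-- `x_{12}`, for `x ∈ A ⊗ End(ℂ^ι)`, in `A ⊗ End(ℂ^ι) ⊗ End(ℂ^κ)`. -/
def leg12 {A : Type*} [CStarAlgebra A] {ι : Type} (κ : Type) [DecidableEq κ]
    (x : Matrix ι ι A) : Matrix (ι × κ) (ι × κ) A :=
  x ⊗ₖ (1 : Matrix κ κ A)

/-- `y_{13}`, for `y ∈ A ⊗ End(ℂ^κ)`, in `A ⊗ End(ℂ^ι) ⊗ End(ℂ^κ)`. -/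
def leg13 {A : Type*} [CStarAlgebra A] (ι : Type) {κ : Type} [DecidableEq ι]
    (y : Matrix κ κ A) : Matrix (ι × κ) (ι × κ) A :=
  (1 : Matrix ι ι A) ⊗ₖ y

/-- The tensor flip `End(ℂ^ι) ⊗ End(ℂ^κ) → End(ℂ^κ) ⊗ End(ℂ^ι)`, with coefficients in `B`. -/
def tensorFlip {B : Type*} {ι κ : Type} (x : Matrix (ι × κ) (ι × κ) B) :
    Matrix (κ × ι) (κ × ι) B :=
  x.submatrix Prod.swap Prod.swap

/-- A C⋆-dynamical system `(A, G, α)`: an action of `G` on the unital C⋆-algebra `A` by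
⋆-automorphisms such that every orbit map is continuous. -/
structure CStarSystem (G A : Type*) [Group G] [TopologicalSpace G] [CStarAlgebra A] where
  /-- the action -/
  act : G →* (A ≃⋆ₐ[ℂ] A)
  continuous_act : ∀ x : A, Continuous fun g => act g x

namespace CStarSystem

variable {G A : Type*} [Group G] [TopologicalSpace G] [CStarAlgebra A]

/-- The fixed point algebra `B = A^G`. -/
def fixed (α : CStarSystem G A) : StarSubalgebra ℂ A where
  carrier := {x | ∀ g, α.act g x = x}
  mul_mem' hx hy g := by rw [map_mul, hx g, hy g]
  add_mem' hx hy g := by rw [map_add, hx g, hy g]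
  algebraMap_mem' c g := by
    rw [Algebra.algebraMap_eq_smul_one, map_smul, map_one]
  star_mem' hx g := by rw [map_star, hx g]

variable {ι : Type} [Fintype ι] [DecidableEq ι]

/-- The generalized isotypic component
`A₂(π) = {x ∈ A ⊗ End(V) | π_g · α_g(x) = x for all g}`. -/
def A₂ (α : CStarSystem G A) (π : URep G ι) : Set (Matrix ι ι A) :=
  {x | ∀ g, scal A (π.mat g) * x.map (α.act g) = x}

/-- The system is cleft: `A₂(π)` contains a unitary for each irreducible `π`. -/
def IsCleft (α : CStarSystem G A) : Prop :=
  ∀ π : Irrep G, ∃ u ∈ α.A₂ π.rep, u ∈ unitary (Matrix (Fin π.dim) (Fin π.dim) A)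

/-- `s` is a non-degenerate isometry in `A₂(π)`. -/
def IsNondegIsometry (α : CStarSystem G A) (π : URep G ι) (s : Matrix ι ι A) : Prop :=
  s ∈ α.A₂ π ∧ sᴴ * s = 1 ∧ ∀ x ∈ α.A₂ π, s * sᴴ * x = x

/-- A family of non-degenerate isometries `s_π ∈ A₂(π)`, `π ∈ Ĝ`, with `s_1 = 1` for the trivial
representation `1` (the irreducible representation in which every `g` acts as the identity). -/
structure IsometryFamily (α : CStarSystem G A) (R : Representatives G) where
  /-- the isometries -/
  s : ∀ p : Dual G, Matrix (Fin (R.dim p)) (Fin (R.dim p)) A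
  nondeg : ∀ p, α.IsNondegIsometry (R.rep p) (s p)
  normalized : ∀ p, (∀ g, (R.rep p).mat g = 1) → s p = 1

/-- `s_τ = ∑ₖ v_k s_{σ_k} v_k*` for a representation `τ` with the decomposition `D`. -/
def IsometryFamily.extend {α : CStarSystem G A} {R : Representatives G}
    (S : α.IsometryFamily R) {τ : URep G ι} (D : Decomposition R τ) : Matrix ι ι A :=
  ∑ k, scal A (D.v k) * S.s (D.comp k) * scal A (D.v k)ᴴ

end CStarSystem

/-! ### Factor systems -/

/-- A pair `(γ, ω)` of families `γ_π : B → B ⊗ End(V_π)` and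
`ω(π, ρ) ∈ B ⊗ End(V_π ⊗ V_ρ)`, indexed by `Ĝ`. -/
structure FactorPair {G : Type*} [Group G] [TopologicalSpace G] (R : Representatives G)
    (B : Type*) where
  /-- the maps `γ_π` -/
  γ : ∀ p : Dual G, B → Matrix (Fin (R.dim p)) (Fin (R.dim p)) B
  /-- the elements `ω(π, ρ)` -/
  ω : ∀ p q : Dual G,
    Matrix (Fin (R.dim p) × Fin (R.dim q)) (Fin (R.dim p) × Fin (R.dim q)) B

/-- `(γ, ω)` is the factor system associated with the family `s = (s_π)`:
`γ_π(b) = s_π* (b ⊗ 1) s_π` and `ω(π, ρ) = s_{π ⊗ ρ}* (s_π)_{12} (s_ρ)_{13}`. The equations are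
read in `A ⊗ End(V_π)` and `A ⊗ End(V_π ⊗ V_ρ)`; they determine `(γ, ω)`. The choice of the
decomposition that defines `s_{π ⊗ ρ}` does not matter. -/
def FactorPair.IsAssociatedWith {G A : Type*} [Group G] [TopologicalSpace G] [CStarAlgebra A]
    {α : CStarSystem G A} {R : Representatives G} (F : FactorPair R α.fixed)
    (S : α.IsometryFamily R) : Prop :=
  (∀ p (b : α.fixed),
    (F.γ p b).map (fun c : α.fixed => (c : A)) =
      (S.s p)ᴴ * Matrix.diagonal (fun _ => (b : A)) * S.s p) ∧
  ∀ p q, ∃ D : Decomposition R ((R.rep p).tensor (R.rep q)),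
    (F.ω p q).map (fun c : α.fixed => (c : A)) =
      (S.extend D)ᴴ * leg12 (Fin (R.dim q)) (S.s p) * leg13 (Fin (R.dim p)) (S.s q)

end CleftSystem

end

/-!
The point is that, `s_p` being unitary in a cleft system, both conditions on the factor system are
commutation relations between generators of `A`.

* `γ_p(b) = b ⊗ 1` holds if and only if `b` commutes with all matrix entries of `s_p`
  (`FactorPair.IsAssociatedWith.γ_eq_diagonal_iff`).
* `ω(q, p) = σ(ω(p, q))` holds if and only if the entries of `s_q` commute with those of `s_p`
  (`FactorPair.IsAssociatedWith.ω_eq_tensorFlip_iff`). Here one needs that `s_τ` is independent of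
  the decomposition of `τ`, which follows from Schur's lemma, so that the flip carries `s_{p ⊗ q}`
  to `s_{q ⊗ p}`.

One direction is then immediate. For the other one, the fixed point algebra `B` and the entries of
all `s_p` together consist of commuting elements, and they generate a dense subalgebra of `A`
(`CStarSystem.IsometryFamily.topologicalClosure_adjoin`). Indeed every `X ∈ A₂(p)` is
`s_p (s_p⋆ X)` with `s_p⋆ X` a matrix over `B`, and the entries of the elements of all `A₂(π)` span
a dense subspace of `A` (`CStarSystem.topologicalClosure_span_entries`).

The last fact rests on the Peter–Weyl theorem, in the form that a continuous function on `G`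
orthogonal to all matrix coefficients of irreducible representations is zero
(`eq_zero_of_integral_coeff_mul_eq_zero`). It is proved here from the spectral theorem for compact
self-adjoint operators, applied to a convolution operator on `L²(G)`.
-/

namespace CleftSystem

section Matrices

variable {G : Type*} [Group G] [TopologicalSpace G] {ι : Type} [Fintype ι] [DecidableEq ι]

theorem URep.mat_mul (π : URep G ι) (g h : G) : π.mat (g * h) = π.mat g * π.mat h := by
  simp only [URep.mat, map_mul]
  rfl

theorem URep.mat_inv (π : URep G ι) (g : G) : π.mat g⁻¹ = (π.mat g)ᴴ := by
  simp only [URep.mat, map_inv]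
  rfl

theorem URep.conjTranspose_mul_mat (π : URep G ι) (g : G) : (π.mat g)ᴴ * π.mat g = 1 :=
  Matrix.mem_unitaryGroup_iff'.1 (π g).2

theorem URep.continuous_mat (π : URep G ι) (i j : ι) :
    Continuous fun g => π.mat g i j :=
  (continuous_subtype_val.comp π.continuous_toFun).matrix_elem i j

end Matrices

/-! ### Invariant subspaces of a unitary action on a Hilbert space -/

section Hilbert

variable {G : Type*} [Group G] {H : Type*} [NormedAddCommGroup H] [InnerProductSpace ℂ H]

/-- The subspace `W` is stable under the unitary action `U`. Only one inclusion is asked for; as `G`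
is a group, `U g` then maps `W` onto itself. -/
def IsInvariant (U : G →* (H →ₗᵢ[ℂ] H)) (W : Submodule ℂ H) : Prop :=
  ∀ g, ∀ v ∈ W, U g v ∈ W

theorem apply_apply_inv (U : G →* (H →ₗᵢ[ℂ] H)) (g : G) (v : H) : U g (U g⁻¹ v) = v := by
  have h : (U g * U g⁻¹) v = v := by
    rw [← map_mul, mul_inv_cancel, map_one, LinearIsometry.coe_one, id]
  exact h

theorem inner_apply_left (U : G →* (H →ₗᵢ[ℂ] H)) (g : G) (v w : H) :
    inner ℂ (U g v) w = inner ℂ v (U g⁻¹ w) := by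
  conv_lhs => rw [← apply_apply_inv U g w]
  exact (U g).inner_map_map _ _

theorem IsInvariant.orthogonal {U : G →* (H →ₗᵢ[ℂ] H)} {W : Submodule ℂ H}
    (hW : IsInvariant U W) : IsInvariant U Wᗮ := by
  intro g v hv
  rw [Submodule.mem_orthogonal'] at hv ⊢
  intro w hw
  rw [inner_apply_left]
  exact hv _ (hW _ _ hw)

theorem IsInvariant.inf {U : G →* (H →ₗᵢ[ℂ] H)} {V W : Submodule ℂ H}
    (hV : IsInvariant U V) (hW : IsInvariant U W) : IsInvariant U (V ⊓ W) :=
  fun g v hv => ⟨hV g v hv.1, hW g v hv.2⟩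

/-- Complete reducibility, in the form in which it is used: a finite-dimensional invariant subspace
of `D` lies in `Q` as soon as all minimal ones do. A non-minimal `W` splits as `P ⊕ (Pᗮ ⊓ W)` with
both summands invariant and of smaller dimension. -/
theorem IsInvariant.le_of_minimal_le {U : G →* (H →ₗᵢ[ℂ] H)} {D Q : Submodule ℂ H}
    (hQ : ∀ W ≤ D, FiniteDimensional ℂ W → IsInvariant U W → W ≠ ⊥ →
      (∀ P ≤ W, IsInvariant U P → P = ⊥ ∨ P = W) → W ≤ Q)
    {W : Submodule ℂ H} (hWD : W ≤ D) [FiniteDimensional ℂ W] (hW : IsInvariant U W) :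
    W ≤ Q := by
  induction h : Module.finrank ℂ W using Nat.strong_induction_on generalizing W with
  | _ n ih =>
    subst h
    by_cases h0 : W = ⊥
    · simp [h0]
    by_cases hmin : ∀ P ≤ W, IsInvariant U P → P = ⊥ ∨ P = W
    · exact hQ W hWD ‹_› hW h0 hmin
    push Not at hmin
    obtain ⟨P, hPW, hP, hP0, hP1⟩ := hmin
    have hlt : P < W := lt_of_le_of_ne hPW hP1
    have : FiniteDimensional ℂ P := Submodule.finiteDimensional_of_le hPW
    have hcompl : P ⊔ Pᗮ ⊓ W = W := Submodule.sup_orthogonal_inf_of_hasOrthogonalProjection hPW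
    have hlt' : Pᗮ ⊓ W < W := by
      refine lt_of_le_of_ne inf_le_right fun he => hP0 ?_
      have : P ≤ Pᗮ := hPW.trans (he ▸ inf_le_left)
      exact (Submodule.isOrtho_self).1 this
    have : FiniteDimensional ℂ (Pᗮ ⊓ W : Submodule ℂ H) := Submodule.finiteDimensional_of_le hlt'.le
    rw [← hcompl]
    exact sup_le (ih _ (Submodule.finrank_lt_finrank_of_lt hlt) (hPW.trans hWD) hP rfl)
      (ih _ (Submodule.finrank_lt_finrank_of_lt hlt') (hlt'.le.trans hWD)
        (hP.orthogonal.inf hW) rfl)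

open ContinuousLinearMap in
/-- If a compact operator `S` with range in `D` commutes with the action, then its adjoint kills
every vector orthogonal to the finite-dimensional invariant subspaces of `D`: the eigenspaces of
`S S⋆` for nonzero eigenvalues are such subspaces, so the spectral theorem gives `S S⋆ c = 0`. -/
theorem adjoint_apply_eq_zero_of_orthogonal [CompleteSpace H] {U : G →* (H →ₗᵢ[ℂ] H)}
    {D : Submodule ℂ H} {S : H →L[ℂ] H} (hS : IsCompactOperator S)
    (hSU : ∀ g v, S (U g v) = U g (S v)) (hSD : ∀ v, S v ∈ D) {c : H}
    (hc : ∀ W ≤ D, FiniteDimensional ℂ W → IsInvariant U W → ∀ w ∈ W, inner ℂ w c = 0) :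
    adjoint S c = 0 := by
  have hadj : ∀ g v, adjoint S (U g v) = U g (adjoint S v) := fun g v => by
    refine ext_inner_right ℂ fun w => ?_
    rw [adjoint_inner_left, inner_apply_left, inner_apply_left, adjoint_inner_left, hSU]
  set T : H →L[ℂ] H := S ∘L adjoint S with hT
  have hTc : IsCompactOperator T := hS.comp_clm (adjoint S)
  have hTs : T.IsSymmetric := fun v w => by
    simp only [hT, coe_comp, Function.comp_apply, coe_coe]
    rw [← adjoint_inner_right, adjoint_inner_left]
  have hTc0 : T c = 0 := by
    -- `T c` is orthogonal to every eigenspace of `T`, the kernel of `T` included.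
    rw [← Submodule.mem_bot ℂ, ← orthogonalComplement_iSup_eigenspaces_eq_bot hTc hTs,
      Submodule.mem_orthogonal]
    intro v hv
    refine Submodule.iSup_induction _ (motive := fun v => inner ℂ v (T c) = 0) hv ?_ (by simp) ?_
    · intro μ v hv
      have hv' : T v = μ • v := Module.End.mem_eigenspace_iff.1 hv
      have h1 : inner ℂ v (T c) = inner ℂ (T v) c := (hTs v c).symm
      rw [h1, hv', inner_smul_left]
      by_cases hμ : μ = 0
      · simp [hμ]
      rw [hc _ ?_ (finite_dimensional_eigenspace hTc μ hμ) ?_ v hv, mul_zero]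
      · intro w hw
        have hw' : T w = μ • w := Module.End.mem_eigenspace_iff.1 hw
        rw [← inv_smul_smul₀ hμ w, ← hw']
        exact D.smul_mem _ (hSD _)
      · intro g w hw
        have hw' : T w = μ • w := Module.End.mem_eigenspace_iff.1 hw
        refine Module.End.mem_eigenspace_iff.2 ?_
        change S (adjoint S (U g w)) = μ • U g w
        rw [hadj, hSU, ← map_smul, ← hw']
        rfl
    · intro v w hv hw
      rw [inner_add_left, hv, hw, add_zero]
  rw [← inner_self_eq_zero (𝕜 := ℂ), adjoint_inner_left]
  change inner ℂ c (T c) = 0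
  rw [hTc0, inner_zero_right]

/-- A minimal nonzero invariant subspace of finite dimension, on which the action is strongly
continuous, is an irreducible representation in matrix form with respect to an orthonormal basis. -/
theorem exists_irrep_of_minimal [TopologicalSpace G] (U : G →* (H →ₗᵢ[ℂ] H))
    (W : Submodule ℂ H) [FiniteDimensional ℂ W] (hW : IsInvariant U W) (hne : W ≠ ⊥)
    (hmin : ∀ P ≤ W, IsInvariant U P → P = ⊥ ∨ P = W)
    (hcont : ∀ v ∈ W, Continuous fun g => U g v) :
    ∃ (π : Irrep G) (b : OrthonormalBasis (Fin π.dim) ℂ W),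
      ∀ g j, U g (b j) = ∑ i, π.rep.mat g i j • (b i : H) := by
  let b := stdOrthonormalBasis ℂ W
  let M : G → Matrix (Fin (Module.finrank ℂ W)) (Fin (Module.finrank ℂ W)) ℂ :=
    fun g => Matrix.of fun i j => inner ℂ (b i : H) (U g (b j))
  have hM : ∀ g j, U g (b j) = ∑ i, M g i j • (b i : H) := fun g j => by
    have := congrArg Subtype.val (b.sum_repr' ⟨U g (b j), hW g _ (b j).2⟩)
    simpa [M] using this.symm
  have hone : M 1 = 1 := by
    ext i j
    simp only [M, map_one, Matrix.of_apply, LinearIsometry.coe_one, id, Matrix.one_apply]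
    exact orthonormal_iff_ite.1 b.orthonormal i j
  have hmul : ∀ g h, M (g * h) = M g * M h := fun g h => by
    ext i j
    have : U (g * h) (b j) = ∑ k, M h k j • U g (b k) := by
      rw [map_mul, LinearIsometry.coe_mul, Function.comp_apply, hM h j, map_sum]
      simp
    simp only [M, Matrix.of_apply, Matrix.mul_apply] at this ⊢
    rw [this, inner_sum]
    simp [inner_smul_right, mul_comm]
  have hstar : ∀ g, (M g)ᴴ = M g⁻¹ := fun g => by
    ext i j
    simp only [M, Matrix.conjTranspose_apply, Matrix.of_apply]
    rw [← inner_apply_left, RCLike.star_def, inner_conj_symm]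
  have hunit : ∀ g, M g ∈ Matrix.unitaryGroup (Fin (Module.finrank ℂ W)) ℂ := fun g => by
    rw [Matrix.mem_unitaryGroup_iff, Matrix.star_eq_conjTranspose, hstar, ← hmul,
      mul_inv_cancel, hone]
  let τ : URep G (Fin (Module.finrank ℂ W)) :=
    { toFun := fun g => ⟨M g, hunit g⟩
      map_one' := Subtype.ext hone
      map_mul' := fun g h => Subtype.ext (hmul g h)
      continuous_toFun := by
        refine Continuous.subtype_mk (continuous_matrix fun i j => ?_) _
        exact continuous_const.inner (hcont _ (b j).2) }
  -- The coordinate map `e` carries subrepresentations of `τ` to invariant subspaces of `W`.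
  let e : (Fin (Module.finrank ℂ W) → ℂ) →ₗ[ℂ] H :=
    W.subtype ∘ₗ (b.toBasis.equivFun.symm : (Fin (Module.finrank ℂ W) → ℂ) →ₗ[ℂ] W)
  have he : ∀ f, e f = ∑ i, f i • (b i : H) := fun f => by
    change ((b.toBasis.equivFun.symm f : W) : H) = _
    rw [Module.Basis.equivFun_symm_apply]
    simp
  have he_inj : Function.Injective e :=
    Subtype.val_injective.comp b.toBasis.equivFun.symm.injective
  have he_range : LinearMap.range e = W := by
    rw [LinearMap.range_comp, LinearEquiv.range, Submodule.map_top, Submodule.range_subtype]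
  have he_eq : ∀ g f, e (τ.toRep g f) = U g (e f) := fun g f => by
    change e (Matrix.toLin' (M g) f) = _
    rw [he, he, map_sum]
    simp only [Matrix.toLin'_apply, Matrix.mulVec, dotProduct, map_smul, hM, Finset.sum_smul,
      Finset.smul_sum, smul_smul]
    rw [Finset.sum_comm]
    simp only [mul_comm]
  have hirr : τ.toRep.IsIrreducible := by
    have key : ∀ P : Subrepresentation τ.toRep, P.toSubmodule = ⊥ ∨ P.toSubmodule = ⊤ := by
      intro P
      have hP : IsInvariant U (P.toSubmodule.map e) := by
        rintro g _ ⟨f, hf, rfl⟩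
        exact ⟨_, P.apply_mem_toSubmodule g hf, he_eq g f⟩
      rcases hmin _ (LinearMap.map_le_range.trans he_range.le) hP with h | h
      · left
        refine Submodule.map_injective_of_injective he_inj ?_
        rw [h, Submodule.map_bot]
      · right
        refine Submodule.map_injective_of_injective he_inj ?_
        rw [h, Submodule.map_top, he_range]
    have hnt : Nontrivial (Subrepresentation τ.toRep) := by
      refine ⟨⟨⊥, ⊤, fun h => hne ?_⟩⟩
      have h' : (⊥ : Submodule ℂ (Fin (Module.finrank ℂ W) → ℂ)) = ⊤ :=
        congrArg Subrepresentation.toSubmodule h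
      rw [← he_range, ← Submodule.map_top, ← h', Submodule.map_bot]
    exact ⟨fun P => (key P).imp (fun h => Subrepresentation.toSubmodule_injective h)
      fun h => Subrepresentation.toSubmodule_injective h⟩
  exact ⟨⟨_, τ, hirr⟩, b, hM⟩

end Hilbert

/-! ### Density of matrix coefficients on a compact group -/

noncomputable section PeterWeyl

open MeasureTheory ContinuousMap

/-- An operator from a Hilbert space to `C(X)` given by a continuous family of vectors `k x` is
compact: by Cauchy–Schwarz the image of the unit ball has `k` as a common bound and as a common
modulus of continuity, so that the Arzelà–Ascoli theorem applies. -/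
theorem isCompactOperator_of_inner {X H : Type*} [TopologicalSpace X] [CompactSpace X]
    [NormedAddCommGroup H] [InnerProductSpace ℂ H] (k : C(X, H)) (R : H →L[ℂ] C(X, ℂ))
    (hR : ∀ φ x, R φ x = inner ℂ (k x) φ) : IsCompactOperator R := by
  let s : Set C(X, ℂ) :=
    {f | (∀ x, ‖f x‖ ≤ ‖k‖) ∧ ∀ x y, dist (f x) (f y) ≤ dist (k x) (k y)}
  -- The same conditions on arbitrary functions: they force continuity and are closed pointwise, so
  -- that `t` is compact by Tychonoff's theorem.
  let t : Set (X → ℂ) :=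
    {f | (∀ x, ‖f x‖ ≤ ‖k‖) ∧ ∀ x y, dist (f x) (f y) ≤ dist (k x) (k y)}
  have ht : IsCompact t := by
    have hc : IsCompact (Set.univ.pi fun _ : X => Metric.closedBall (0 : ℂ) ‖k‖) :=
      isCompact_univ_pi fun _ => isCompact_closedBall _ _
    refine hc.of_isClosed_subset ?_ fun f hf x _ => by simpa using hf.1 x
    simp only [t, Set.ofPred_and, Set.ofPred_forall]
    refine (isClosed_iInter fun x => isClosed_le (continuous_apply x).norm continuous_const).inter
      (isClosed_iInter fun x => isClosed_iInter fun y => isClosed_le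
        ((continuous_apply x).dist (continuous_apply y)) continuous_const)
  have himg : ContinuousMap.toFun '' s = t := by
    ext f
    refine ⟨fun ⟨f', hf', he⟩ => he ▸ hf', fun hf => ⟨⟨f, ?_⟩, hf, rfl⟩⟩
    refine continuous_iff_continuousAt.2 fun x => tendsto_iff_dist_tendsto_zero.2 ?_
    have h0 : Filter.Tendsto (fun y => dist (k y) (k x)) (nhds x) (nhds 0) :=
      tendsto_iff_dist_tendsto_zero.1 k.continuous.continuousAt
    exact squeeze_zero (fun _ => dist_nonneg) (fun y => hf.2 y x) h0
  have hs : IsCompact s := by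
    refine ArzelaAscoli.isCompact_of_equicontinuous s (himg ▸ ht) fun x => ?_
    refine Metric.equicontinuousAt_of_continuity_modulus (fun y => dist (k x) (k y)) ?_ _
      (Filter.Eventually.of_forall fun y f => f.2.2 x y)
    have : Continuous fun y => dist (k x) (k y) := continuous_const.dist k.continuous
    simpa using this.tendsto x
  refine (isCompactOperator_iff_image_closedBall_subset_compact (R : H →ₗ[ℂ] C(X, ℂ))
    zero_lt_one).2 ⟨s, hs, ?_⟩
  rintro _ ⟨φ, hφ, rfl⟩
  have hφ1 : ‖φ‖ ≤ 1 := by simpa using hφ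
  have hle : ∀ v : H, ‖inner ℂ v φ‖ ≤ ‖v‖ := fun v =>
    (norm_inner_le_norm v φ).trans (mul_le_of_le_one_right (norm_nonneg _) hφ1)
  refine ⟨fun x => ?_, fun x y => ?_⟩
  · change ‖R φ x‖ ≤ _
    rw [hR]
    exact (hle _).trans (k.norm_coe_le_norm x)
  · change dist (R φ x) (R φ y) ≤ _
    rw [hR, hR, dist_eq_norm, ← inner_sub_left, dist_eq_norm]
    exact hle _

variable {G : Type*} [Group G] [TopologicalSpace G] [IsTopologicalGroup G]

/-- Left translation of functions: `(translate g f)(x) = f(g⁻¹x)`. -/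
def translate (g : G) (f : C(G, ℂ)) : C(G, ℂ) :=
  f.comp ⟨fun x => g⁻¹ * x, continuous_const.mul continuous_id⟩

theorem translate_apply (g : G) (f : C(G, ℂ)) (x : G) : translate g f x = f (g⁻¹ * x) := rfl

theorem continuous_translate (f : C(G, ℂ)) : Continuous fun g => translate g f := by
  refine ContinuousMap.continuous_of_continuous_uncurry _ ?_
  exact f.continuous.comp (continuous_fst.inv.mul continuous_snd)

variable [CompactSpace G] [MeasurableSpace G] [BorelSpace G]

/-- The left regular representation of `G` on `L²(G)`. -/
def regular (μ : Measure G) [μ.IsMulLeftInvariant] : G →* (Lp ℂ 2 μ →ₗᵢ[ℂ] Lp ℂ 2 μ) where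
  toFun g := Lp.compMeasurePreservingₗᵢ ℂ (fun x => g⁻¹ * x) (measurePreserving_mul_left μ g⁻¹)
  map_one' := by
    ext1 f
    change Lp.compMeasurePreserving _ _ f = f
    simp only [inv_one, one_mul]
    exact Lp.compMeasurePreserving_id_apply f
  map_mul' g h := by
    ext1 f
    change Lp.compMeasurePreserving _ _ f =
      Lp.compMeasurePreserving _ _ (Lp.compMeasurePreserving _ _ f)
    rw [← Lp.compMeasurePreserving_comp_apply]
    congr 1
    ext x
    simp [mul_assoc]

variable (μ : Measure G) [μ.IsHaarMeasure]

theorem regular_toLp (g : G) (f : C(G, ℂ)) :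
    regular μ g (toLp 2 μ ℂ f) = toLp 2 μ ℂ (translate g f) := rfl

/-- The density part of the **Peter–Weyl theorem**: a continuous function on a compact group whose
integral against every matrix coefficient of every irreducible representation vanishes is zero.

The operator `R φ (x) = ∫ c(y⁻¹x) φ(y) dy` from `L²(G)` to `C(G)` is compact and commutes with left
translations. In a finite-dimensional irreducible space of continuous functions the evaluations at
`1` express each function through conjugate matrix coefficients, so `c` is orthogonal to it. Hence
the adjoint of `R`, viewed as an operator on `L²(G)`, kills `c`. This adjoint sends `c` to a
continuous function whose value at `1` is `∫ |c|²`. -/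
theorem eq_zero_of_integral_coeff_mul_eq_zero (c : C(G, ℂ))
    (hc : ∀ (π : Irrep G) i j, ∫ g, π.rep.mat g i j * c g ∂μ = 0) : c = 0 := by
  set J : C(G, ℂ) →L[ℂ] Lp ℂ 2 μ := toLp 2 μ ℂ
  have hJinj : Function.Injective J := toLp_injective μ
  have hinner : ∀ f g : C(G, ℂ), inner ℂ (J f) (J g) = ∫ x, g x * (starRingEnd ℂ) (f x) ∂μ :=
    fun f g => inner_toLp μ f g
  -- The kernel is built from `c` itself; this makes `∫ c(x) • K x` equal to `∫ |c|²` at `1`.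
  let K : C(G, C(G, ℂ)) := ContinuousMap.curry
    ⟨fun p : G × G => (starRingEnd ℂ) (c (p.2⁻¹ * p.1)),
      Complex.continuous_conj.comp (c.continuous.comp (continuous_snd.inv.mul continuous_fst))⟩
  have hK : ∀ x y, K x y = (starRingEnd ℂ) (c (y⁻¹ * x)) := fun _ _ => rfl
  let k : C(G, Lp ℂ 2 μ) := ⟨fun x => J (K x), J.continuous.comp K.continuous⟩
  let R : Lp ℂ 2 μ →L[ℂ] C(G, ℂ) := LinearMap.mkContinuous
    { toFun := fun φ => ⟨fun x => inner ℂ (k x) φ, k.continuous.inner continuous_const⟩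
      map_add' := fun φ ψ => by ext x; simp [inner_add_right]
      map_smul' := fun a φ => by ext x; simp [inner_smul_right] } ‖k‖ fun φ => by
        refine (ContinuousMap.norm_le _ (by positivity)).2 fun x => ?_
        exact (norm_inner_le_norm _ _).trans
          (mul_le_mul_of_nonneg_right (k.norm_coe_le_norm x) (norm_nonneg _))
  have hR : ∀ φ x, R φ x = inner ℂ (J (K x)) φ := fun _ _ => rfl
  have hRU : ∀ g φ, R (regular μ g φ) = translate g (R φ) := fun g φ => by
    ext x
    rw [translate_apply, hR, hR, ← inner_conj_symm, inner_apply_left, inner_conj_symm,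
      regular_toLp]
    congr 2
    ext y
    simp [hK, translate_apply, mul_assoc]
  have hS : IsCompactOperator (J ∘L R) := (isCompactOperator_of_inner k R fun _ _ => rfl).clm_comp J
  have hadj : ContinuousLinearMap.adjoint (J ∘L R) (J c) = 0 := by
    refine adjoint_apply_eq_zero_of_orthogonal (U := regular μ)
      (D := LinearMap.range (J : C(G, ℂ) →ₗ[ℂ] Lp ℂ 2 μ)) hS ?_ (fun v => ⟨R v, rfl⟩) ?_
    · intro g v
      change J (R _) = regular μ g (J (R v))
      rw [hRU, regular_toLp]
    intro W hWD hWfin hW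
    suffices h : W ≤ (ℂ ∙ J c)ᗮ from fun w hw =>
      Submodule.mem_orthogonal_singleton_iff_inner_left.1 (h hw)
    refine IsInvariant.le_of_minimal_le ?_ hWD hW
    clear! W
    intro W hWD hWfin hW hne hmin
    obtain ⟨π, b, hb⟩ := exists_irrep_of_minimal (regular μ) W hW hne hmin fun v hv => by
      obtain ⟨f, rfl⟩ := hWD hv
      exact J.continuous.comp (continuous_translate f)
    choose u hu using fun j => hWD (b j).2
    have hu' : ∀ j, J (u j) = b j := hu
    have hcoeff : ∀ g j, translate g (u j) = ∑ i, π.rep.mat g i j • u i := fun g j => by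
      apply hJinj
      calc J (translate g (u j)) = regular μ g (b j) := by rw [← hu', regular_toLp]
        _ = ∑ i, J (π.rep.mat g i j • u i) := by
          rw [hb]
          exact Finset.sum_congr rfl fun i _ => by rw [← hu', J.map_smul]
        _ = J (∑ i, π.rep.mat g i j • u i) := (map_sum J _ _).symm
    -- Evaluation of `hcoeff` for `g⁻¹` at the point `1`.
    have hconj : ∀ g j, (starRingEnd ℂ) (u j g) =
        ∑ i, π.rep.mat g j i * (starRingEnd ℂ) (u i 1) := fun g j => by
      have h2 := congrArg (fun f : C(G, ℂ) => (starRingEnd ℂ) (f 1)) (hcoeff g⁻¹ j)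
      simpa [translate_apply, URep.mat_inv, ContinuousMap.sum_apply] using h2
    have hb0 : ∀ j, inner ℂ (b j : Lp ℂ 2 μ) (J c) = 0 := fun j => by
      rw [← hu', hinner]
      have hexp : (fun g => c g * (starRingEnd ℂ) (u j g)) = fun g =>
          ∑ i, c g * (π.rep.mat g j i * (starRingEnd ℂ) (u i 1)) :=
        funext fun g => by rw [hconj, Finset.mul_sum]
      rw [hexp, integral_finsetSum]
      · refine Finset.sum_eq_zero fun i _ => ?_
        rw [← mul_zero ((starRingEnd ℂ) (u i 1)), ← hc π j i, ← integral_const_mul]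
        congr 1
        ext g
        ring
      · intro i _
        exact (c.continuous.mul
          ((π.rep.continuous_mat j i).mul continuous_const)).integrable_of_hasCompactSupport
          (HasCompactSupport.of_compactSpace _)
    intro w hw
    rw [Submodule.mem_orthogonal_singleton_iff_inner_left]
    have hw' := congrArg Subtype.val (b.sum_repr ⟨w, hw⟩)
    rw [← show _ = w from hw']
    simp only [Submodule.coe_sum, Submodule.coe_smul, sum_inner, inner_smul_left, hb0, mul_zero,
      Finset.sum_const_zero]
  have hcK : Integrable (fun x => c x • K x) μ :=
    (c.continuous.smul K.continuous).integrable_of_hasCompactSupport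
      (HasCompactSupport.of_compactSpace _)
  -- The integral below is the adjoint of `J ∘ R` applied to `J c`.
  have hzero : J (∫ x, c x • K x ∂μ) = 0 := by
    refine ext_inner_left ℂ fun φ => ?_
    rw [inner_zero_right, ← J.integral_comp_comm hcK, ← integral_inner (J.integrable_comp hcK)]
    have h1 : inner ℂ φ (ContinuousLinearMap.adjoint (J ∘L R) (J c)) = 0 := by
      rw [hadj, inner_zero_right]
    rw [ContinuousLinearMap.adjoint_inner_right] at h1
    change inner ℂ (J (R φ)) (J c) = 0 at h1
    rw [hinner] at h1
    rw [← h1]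
    congr 1
    ext x
    rw [map_smul, inner_smul_right, hR, inner_conj_symm]
  have hzero' : ∫ x, c x • K x ∂μ = 0 := hJinj (hzero.trans (map_zero J).symm)
  have heval := congrArg (ContinuousMap.evalCLM ℂ (1 : G)) hzero'
  rw [← ContinuousLinearMap.integral_comp_comm _ hcK] at heval
  apply hJinj
  rw [map_zero, ← inner_self_eq_zero (𝕜 := ℂ), hinner]
  simpa [hK] using heval

end PeterWeyl

/-! ### Density of the isotypic components -/

section Density

open MeasureTheory

variable {G A : Type*} [Group G] [TopologicalSpace G] [CompactSpace G] [CStarAlgebra A]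

theorem CStarSystem.integrable_coeff_smul [MeasurableSpace G] [BorelSpace G] (μ : Measure G)
    [μ.IsHaarMeasure] (α : CStarSystem G A) {ι : Type} [Fintype ι] [DecidableEq ι] (π : URep G ι)
    (x : A) (i j : ι) : Integrable (fun g => π.mat g i j • α.act g x) μ :=
  ((π.continuous_mat i j).smul (α.continuous_act x)).integrable_of_hasCompactSupport
    (HasCompactSupport.of_compactSpace _)

variable [IsTopologicalGroup G]

open scoped CStarAlgebra in
/-- Averaging `α_g(x)` against the matrix coefficients of `π` gives an element of `A₂(π)`, by left
invariance of Haar measure. -/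
theorem CStarSystem.integral_coeff_smul_mem_A₂ [MeasurableSpace G] [BorelSpace G] (μ : Measure G)
    [μ.IsHaarMeasure] (α : CStarSystem G A) {ι : Type} [Fintype ι] [DecidableEq ι] (π : URep G ι)
    (x : A) :
    (Matrix.of fun i j => ∫ g, π.mat g i j • α.act g x ∂μ) ∈ α.A₂ π := by
  intro h
  let L : A →L[ℂ] A := ⟨((α.act h : A ≃⋆ₐ[ℂ] A).toAlgEquiv : A →ₐ[ℂ] A).toLinearMap,
    map_continuous (α.act h)⟩
  have hL : ∀ a, α.act h a = L a := fun _ => rfl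
  ext i k
  simp only [Matrix.mul_apply, Matrix.map_apply, Matrix.of_apply, scal, ← Algebra.smul_def]
  have hswap : ∀ j, α.act h (∫ g, π.mat g j k • α.act g x ∂μ) =
      ∫ g, π.mat g j k • α.act (h * g) x ∂μ := fun j => by
    rw [hL, ← L.integral_comp_comm (α.integrable_coeff_smul μ π x j k)]
    congr 1
    ext g
    rw [map_smul, ← hL, map_mul]
    rfl
  have hshift : ∀ j, Integrable (fun g => π.mat g j k • α.act (h * g) x) μ := fun j =>
    ((π.continuous_mat j k).smul ((α.continuous_act x).comp
      (continuous_const.mul continuous_id))).integrable_of_hasCompactSupport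
      (HasCompactSupport.of_compactSpace _)
  simp only [hswap, ← integral_smul]
  rw [← integral_finsetSum _ fun j _ => by exact (hshift j).smul (π.mat h i j)]
  rw [← integral_mul_left_eq_self (fun g => π.mat g i k • α.act g x) h]
  congr 1
  ext g
  rw [π.mat_mul, Matrix.mul_apply, Finset.sum_smul]
  exact Finset.sum_congr rfl fun j _ => smul_smul _ _ _

/-- The matrix entries of the elements of all `A₂(π)` span a dense subspace. If a continuous
functional `φ` vanishes on them, then `g ↦ φ(α_g(x))` is orthogonal to all matrix coefficients and
so is zero; its value at `1` is `φ(x)`. -/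
theorem CStarSystem.topologicalClosure_span_entries (α : CStarSystem G A) :
    (Submodule.span ℂ {a : A | ∃ (π : Irrep G), ∃ x ∈ α.A₂ π.rep, ∃ i j,
      x i j = a}).topologicalClosure = ⊤ := by
  set E := Submodule.span ℂ {a : A | ∃ (π : Irrep G), ∃ x ∈ α.A₂ π.rep, ∃ i j, x i j = a}
  rw [eq_top_iff]
  intro x _
  by_contra hx
  -- Used by instance search: the quotient by a closed subspace is a normed space.
  have hclosed : IsClosed (E.topologicalClosure : Set A) := E.isClosed_topologicalClosure
  have hx' : ‖E.topologicalClosure.mkQL x‖ ≠ 0 := fun h =>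
    hx ((Submodule.Quotient.mk_eq_zero _).1 (norm_eq_zero.1 h))
  obtain ⟨f, -, hf⟩ := exists_dual_vector ℂ _ hx'
  let φ : A →L[ℂ] ℂ := f ∘L E.topologicalClosure.mkQL
  have hφE : ∀ a ∈ E, φ a = 0 := fun a ha => by
    have : E.topologicalClosure.mkQL a = 0 :=
      (Submodule.Quotient.mk_eq_zero _).2 (E.le_topologicalClosure ha)
    simp [φ, this]
  let _ : MeasurableSpace G := borel G
  have : BorelSpace G := ⟨rfl⟩
  let c : C(G, ℂ) := ⟨fun g => φ (α.act g x), φ.continuous.comp (α.continuous_act x)⟩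
  have hc : c = 0 := by
    refine eq_zero_of_integral_coeff_mul_eq_zero (Measure.haar : Measure G) c fun π i j => ?_
    have h := hφE _ (Submodule.subset_span
      ⟨π, _, α.integral_coeff_smul_mem_A₂ Measure.haar π.rep x, i, j, rfl⟩)
    rw [Matrix.of_apply, ← φ.integral_comp_comm
      (α.integrable_coeff_smul Measure.haar π.rep x i j)] at h
    simp only [map_smul, smul_eq_mul] at h
    exact h
  have h1 : c 1 = 0 := by rw [hc]; rfl
  have h2 : φ x = 0 := by simpa [c] using h1
  exact hx' (Complex.ofReal_eq_zero.1 (hf.symm.trans h2))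

end Density

/-! ### Intertwiners and Schur's lemma -/

section Schur

variable {G : Type*} [Group G] [TopologicalSpace G]
variable {ι κ ν : Type} [Fintype ι] [DecidableEq ι] [Fintype κ] [DecidableEq κ]
  [Fintype ν] [DecidableEq ν]

theorem Intertwines.mul {π : URep G ι} {ρ : URep G κ} {τ : URep G ν} {w : Matrix ν κ ℂ}
    {v : Matrix κ ι ℂ} (hw : Intertwines ρ τ w) (hv : Intertwines π ρ v) :
    Intertwines π τ (w * v) := fun g => by
  rw [Matrix.mul_assoc, hv g, ← Matrix.mul_assoc, hw g, Matrix.mul_assoc]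

theorem Intertwines.conjTranspose {π : URep G ι} {ρ : URep G κ} {v : Matrix κ ι ℂ}
    (hv : Intertwines π ρ v) : Intertwines ρ π vᴴ := fun g => by
  have h := congrArg Matrix.conjTranspose (hv g⁻¹)
  simpa [Matrix.conjTranspose_mul, URep.mat_inv] using h.symm

/-- **Schur's lemma** for a self-intertwiner of an irreducible representation. -/
theorem Intertwines.exists_eq_smul_one {π : URep G ι} (hπ : π.toRep.IsIrreducible)
    {w : Matrix ι ι ℂ} (hw : Intertwines π π w) : ∃ c : ℂ, w = c • 1 := by
  let f : Representation.IntertwiningMap π.toRep π.toRep :=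
    ⟨Matrix.toLin' w, fun g => by
      change Matrix.toLin' w ∘ₗ Matrix.toLin' (π.mat g) = Matrix.toLin' (π.mat g) ∘ₗ Matrix.toLin' w
      rw [← Matrix.toLin'_mul, ← Matrix.toLin'_mul, hw g]⟩
  obtain ⟨c, hc⟩ :=
    Representation.IsIrreducible.algebraMap_intertwiningMap_bijective_of_isAlgClosed.2 f
  refine ⟨c, Matrix.toLin'.injective ?_⟩
  have h : (algebraMap ℂ (Representation.IntertwiningMap π.toRep π.toRep) c).toLinearMap =
      Matrix.toLin' w := congrArg Representation.IntertwiningMap.toLinearMap hc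
  rw [← h, map_smul, Matrix.toLin'_one, Algebra.algebraMap_eq_smul_one]
  rfl

/-- **Schur's lemma** for two irreducible representations: a nonzero intertwiner `w` is a positive
multiple of a unitary one, since `w⋆w` and `ww⋆` are the same scalar. -/
theorem Intertwines.equivalent_of_ne_zero {π ρ : Irrep G} {w : Matrix (Fin ρ.dim) (Fin π.dim) ℂ}
    (hw : Intertwines π.rep ρ.rep w) (h0 : w ≠ 0) : Irrep.Equivalent G π ρ := by
  obtain ⟨c, hc⟩ := Intertwines.exists_eq_smul_one π.irreducible (hw.conjTranspose.mul hw)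
  obtain ⟨d, hd⟩ := Intertwines.exists_eq_smul_one ρ.irreducible (hw.mul hw.conjTranspose)
  have hcd : d = c := by
    have h : d • w = c • w := by
      have := Matrix.mul_assoc w wᴴ w
      simpa [hc, hd] using this
    exact smul_left_injective ℂ h0 h
  subst hcd
  obtain ⟨i, j, hij⟩ : ∃ i j, w i j ≠ 0 := by
    by_contra! h
    exact h0 (Matrix.ext h)
  have hd_eq : d = ((∑ k, Complex.normSq (w k j) : ℝ) : ℂ) := by
    have := congrFun (congrFun hc j) j
    simp only [Matrix.mul_apply, Matrix.conjTranspose_apply, Matrix.smul_apply,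
      Matrix.one_apply_eq, smul_eq_mul, mul_one] at this
    rw [← this, Complex.ofReal_sum]
    exact Finset.sum_congr rfl fun k _ => Complex.normSq_eq_conj_mul_self.symm
  set r : ℝ := ∑ k, Complex.normSq (w k j)
  have hr0 : 0 < r := (Complex.normSq_pos.2 hij).trans_le
    (Finset.single_le_sum (f := fun k => Complex.normSq (w k j))
      (fun k _ => Complex.normSq_nonneg _) (Finset.mem_univ i))
  set t : ℝ := (Real.sqrt r)⁻¹
  have hscale : (t : ℂ) * t * d = 1 := by
    rw [hd_eq]
    norm_cast
    rw [← mul_inv, Real.mul_self_sqrt hr0.le, inv_mul_cancel₀ hr0.ne']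
  have hstar : star (t : ℂ) = t := Complex.conj_ofReal _
  refine ⟨(t : ℂ) • w, ?_, ?_, fun g => ?_⟩
  · rw [Matrix.conjTranspose_smul, hstar, Matrix.smul_mul, Matrix.mul_smul, hc, smul_smul,
      smul_smul, hscale, one_smul]
  · rw [Matrix.conjTranspose_smul, hstar, Matrix.smul_mul, Matrix.mul_smul, hd, smul_smul,
      smul_smul, hscale, one_smul]
  · rw [Matrix.smul_mul, Matrix.mul_smul, hw g]

end Schur

/-! ### Matrix calculus over a C⋆-algebra -/

section Scal

variable {A : Type*} [CStarAlgebra A] {ι κ ν : Type}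

theorem scal_mul [Fintype κ] (m : Matrix ι κ ℂ) (n : Matrix κ ν ℂ) :
    scal A (m * n) = scal A m * scal A n := Matrix.map_mul

theorem scal_conjTranspose (m : Matrix ι κ ℂ) : scal A mᴴ = (scal A m)ᴴ := by
  ext i j
  exact algebraMap_star_comm _

theorem scal_one [DecidableEq ι] : scal A (1 : Matrix ι ι ℂ) = 1 :=
  Matrix.map_one _ (map_zero _) (map_one _)

theorem scal_zero : scal A (0 : Matrix ι κ ℂ) = 0 := Matrix.map_zero _ (map_zero _)

theorem scal_sum {μ : Type} (s : Finset μ) (m : μ → Matrix ι κ ℂ) :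
    scal A (∑ k ∈ s, m k) = ∑ k ∈ s, scal A (m k) := by
  ext i j
  simp [scal, Matrix.sum_apply]

theorem scal_smul_one [DecidableEq ι] (c : ℂ) : scal A (c • (1 : Matrix ι ι ℂ)) = c • 1 := by
  ext i j
  simp [scal, Matrix.one_apply, apply_ite (algebraMap ℂ A), Algebra.smul_def]

end Scal

section Legs

variable {A : Type*} [CStarAlgebra A]

theorem tensorFlip_leg12 {ι κ : Type} [DecidableEq κ] (x : Matrix ι ι A) :
    tensorFlip (leg12 κ x) = leg13 κ x := by
  ext ⟨k, i⟩ ⟨l, j⟩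
  simp [tensorFlip, leg12, leg13, Matrix.one_apply]

theorem tensorFlip_leg13 {ι κ : Type} [DecidableEq ι] (y : Matrix κ κ A) :
    tensorFlip (leg13 ι y) = leg12 ι y := by
  ext ⟨k, i⟩ ⟨l, j⟩
  simp [tensorFlip, leg12, leg13, Matrix.one_apply]

theorem tensorFlip_mul {ι κ : Type} [Fintype ι] [Fintype κ] (x y : Matrix (ι × κ) (ι × κ) A) :
    tensorFlip (x * y) = tensorFlip x * tensorFlip y :=
  Matrix.submatrix_mul _ _ _ _ _ Prod.swap_bijective

variable {ι κ : Type} [Fintype ι] [DecidableEq ι] [Fintype κ]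
  [DecidableEq κ]

theorem leg12_mul_leg13_apply (x : Matrix ι ι A) (y : Matrix κ κ A) (i j : ι) (k l : κ) :
    (leg12 κ x * leg13 ι y) (i, k) (j, l) = x i j * y k l := by
  simp [leg12, leg13, Matrix.mul_apply, Fintype.sum_prod_type, Matrix.one_apply]

theorem leg13_mul_leg12_apply (x : Matrix ι ι A) (y : Matrix κ κ A) (i j : ι) (k l : κ) :
    (leg13 ι y * leg12 κ x) (i, k) (j, l) = y k l * x i j := by
  simp [leg12, leg13, Matrix.mul_apply, Fintype.sum_prod_type, Matrix.one_apply]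

/-- The two legs commute exactly when the entries of the two matrices do. -/
theorem leg12_mul_leg13_eq_iff (x : Matrix ι ι A) (y : Matrix κ κ A) :
    leg12 κ x * leg13 ι y = leg13 ι y * leg12 κ x ↔ ∀ i j k l, Commute (x i j) (y k l) := by
  constructor
  · intro h i j k l
    have := congrFun (congrFun h (i, k)) (j, l)
    rwa [leg12_mul_leg13_apply, leg13_mul_leg12_apply] at this
  · rintro h
    ext ⟨i, k⟩ ⟨j, l⟩
    rw [leg12_mul_leg13_apply, leg13_mul_leg12_apply]
    exact h i j k l

end Legs

/-! ### Families of unitaries and their factor systems -/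

section Family

variable {G A : Type*} [Group G] [TopologicalSpace G] [CStarAlgebra A] {α : CStarSystem G A}
  {R : Representatives G} (S : α.IsometryFamily R)
variable {ι κ : Type} [Fintype ι] [DecidableEq ι] [Fintype κ] [DecidableEq κ]

/-- In a cleft system a nondegenerate isometry is unitary: `s s⋆` fixes a unitary of `A₂(π)`. -/
theorem CStarSystem.IsometryFamily.mul_conjTranspose (hcleft : α.IsCleft) (p : Dual G) :
    S.s p * (S.s p)ᴴ = 1 := by
  obtain ⟨u, hu, huu⟩ := hcleft (R.irrep p)
  have h1 : u * uᴴ = 1 := (Unitary.mem_iff.1 huu).2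
  have h2 := (S.nondeg p).2.2 u hu
  rw [← Matrix.mul_one (S.s p * (S.s p)ᴴ), ← h1, ← Matrix.mul_assoc, h2]

/-- Naturality of `p ↦ s_p` with respect to intertwiners. By Schur's lemma these are scalars for
`p = q` and zero otherwise. -/
theorem CStarSystem.IsometryFamily.scal_mul_s {p q : Dual G}
    {w : Matrix (Fin (R.dim q)) (Fin (R.dim p)) ℂ} (hw : Intertwines (R.rep p) (R.rep q) w) :
    scal A w * S.s p = S.s q * scal A w := by
  by_cases h0 : w = 0
  · rw [h0, scal_zero, Matrix.zero_mul, Matrix.mul_zero]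
  have hpq : p = q := by
    rw [← R.spec p, ← R.spec q]
    exact Quotient.sound (hw.equivalent_of_ne_zero h0)
  subst hpq
  obtain ⟨c, rfl⟩ := Intertwines.exists_eq_smul_one (R.irrep p).irreducible hw
  rw [scal_smul_one, Matrix.smul_mul, Matrix.mul_smul, Matrix.one_mul, Matrix.mul_one]

theorem CStarSystem.IsometryFamily.scal_mul_conjTranspose_s {p q : Dual G}
    {w : Matrix (Fin (R.dim q)) (Fin (R.dim p)) ℂ} (hw : Intertwines (R.rep p) (R.rep q) w) :
    scal A w * (S.s p)ᴴ = (S.s q)ᴴ * scal A w := by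
  have h := congrArg Matrix.conjTranspose (S.scal_mul_s hw.conjTranspose)
  simpa [Matrix.conjTranspose_mul, scal_conjTranspose] using h.symm

/-- The element `s_τ` does not depend on the decomposition of `τ` that defines it. -/
theorem CStarSystem.IsometryFamily.extend_eq_extend {τ : URep G ι} (D D' : Decomposition R τ) :
    S.extend D = S.extend D' := by
  have key : ∀ k l, scal A (D'.v l * (D'.v l)ᴴ) *
      (scal A (D.v k) * S.s (D.comp k) * scal A (D.v k)ᴴ) =
      scal A (D'.v l) * S.s (D'.comp l) * scal A (D'.v l)ᴴ * scal A (D.v k * (D.v k)ᴴ) := by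
    intro k l
    have h := S.scal_mul_s ((D'.intertwines l).conjTranspose.mul (D.intertwines k))
    rw [scal_mul] at h
    calc _ = scal A (D'.v l) * (scal A (D'.v l)ᴴ * scal A (D.v k) * S.s (D.comp k)) *
          scal A (D.v k)ᴴ := by
          simp only [scal_mul, Matrix.mul_assoc]
      _ = _ := by
          rw [h]
          simp only [scal_mul, Matrix.mul_assoc]
  calc S.extend D = (∑ l, scal A (D'.v l * (D'.v l)ᴴ)) * S.extend D := by
        rw [← scal_sum, D'.complete, scal_one, Matrix.one_mul]
    _ = S.extend D' * ∑ k, scal A (D.v k * (D.v k)ᴴ) := by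
        simp only [extend, Finset.sum_mul, Finset.mul_sum, key]
    _ = S.extend D' := by rw [← scal_sum, D.complete, scal_one, Matrix.mul_one]

theorem CStarSystem.IsometryFamily.extend_mul_conjTranspose (hcleft : α.IsCleft) {τ : URep G ι}
    (D : Decomposition R τ) : S.extend D * (S.extend D)ᴴ = 1 := by
  have hE : (S.extend D)ᴴ = ∑ l, scal A (D.v l) * (S.s (D.comp l))ᴴ * scal A (D.v l)ᴴ := by
    simp [extend, Matrix.conjTranspose_sum, Matrix.conjTranspose_mul, scal_conjTranspose,
      Matrix.mul_assoc]
  have key : ∀ k l, scal A (D.v k) * S.s (D.comp k) * scal A (D.v k)ᴴ *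
      (scal A (D.v l) * (S.s (D.comp l))ᴴ * scal A (D.v l)ᴴ) =
      scal A (D.v k * (D.v k)ᴴ) * scal A (D.v l * (D.v l)ᴴ) := by
    intro k l
    have h := S.scal_mul_conjTranspose_s ((D.intertwines k).conjTranspose.mul (D.intertwines l))
    rw [scal_mul] at h
    calc _ = scal A (D.v k) * S.s (D.comp k) * (scal A (D.v k)ᴴ *
          scal A (D.v l) * (S.s (D.comp l))ᴴ) * scal A (D.v l)ᴴ := by
          simp only [Matrix.mul_assoc]
      _ = scal A (D.v k) * (S.s (D.comp k) * (S.s (D.comp k))ᴴ) * (scal A (D.v k)ᴴ *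
          scal A (D.v l)) * scal A (D.v l)ᴴ := by
          rw [h]
          simp only [Matrix.mul_assoc]
      _ = _ := by
          rw [S.mul_conjTranspose hcleft]
          simp only [scal_mul, Matrix.mul_assoc, Matrix.one_mul]
  rw [hE, extend]
  simp only [Finset.sum_mul, Finset.mul_sum, key]
  simp only [← Finset.mul_sum, ← Finset.sum_mul, ← scal_sum, D.complete, scal_one, mul_one]

/-- The decomposition of `π ⊗ ρ` obtained from one of `ρ ⊗ π` by flipping the tensor factors in the
target of each intertwiner. -/
def Decomposition.flip {π : URep G ι} {ρ : URep G κ} (D : Decomposition R (ρ.tensor π)) :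
    Decomposition R (π.tensor ρ) where
  len := D.len
  comp := D.comp
  v k := (D.v k).submatrix Prod.swap id
  intertwines k g := by
    have h : (π.tensor ρ).mat g = ((ρ.tensor π).mat g).submatrix Prod.swap Prod.swap := by
      ext ⟨i, k⟩ ⟨j, l⟩
      exact mul_comm _ _
    rw [h, ← Matrix.submatrix_mul _ _ _ _ _ Prod.swap_bijective, ← D.intertwines k g,
      Matrix.submatrix_mul _ _ _ _ _ Function.bijective_id, Matrix.submatrix_id_id]
  isometry k := by
    rw [Matrix.conjTranspose_submatrix, ← Matrix.submatrix_mul _ _ _ _ _ Prod.swap_bijective,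
      D.isometry k, Matrix.submatrix_id_id]
  complete := by
    have h : ∀ k, (D.v k).submatrix Prod.swap id * ((D.v k).submatrix Prod.swap id)ᴴ =
        (D.v k * (D.v k)ᴴ).submatrix Prod.swap Prod.swap := fun k => by
      rw [Matrix.conjTranspose_submatrix, ← Matrix.submatrix_mul _ _ _ _ _ Function.bijective_id]
    have h2 := congrArg (fun m => m.submatrix (Prod.swap : ι × κ → κ × ι) Prod.swap) D.complete
    simp only [h]
    ext i j
    have h3 := congrFun (congrFun h2 i) j
    simpa [Matrix.sum_apply, Matrix.one_apply, Prod.swap_inj] using h3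

theorem CStarSystem.IsometryFamily.extend_flip {π : URep G ι} {ρ : URep G κ}
    (D : Decomposition R (ρ.tensor π)) : S.extend D.flip = tensorFlip (S.extend D) := by
  ext i j
  simp only [extend, tensorFlip, Matrix.submatrix_apply, Matrix.sum_apply]
  rfl

/-- As `s_p` is unitary, `γ_p(b) = b ⊗ 1` says that `b ⊗ 1` commutes with `s_p`. -/
theorem FactorPair.IsAssociatedWith.γ_eq_diagonal_iff {F : FactorPair R α.fixed}
    (hF : F.IsAssociatedWith S) (hcleft : α.IsCleft) (p : Dual G) (b : α.fixed) :
    F.γ p b = Matrix.diagonal (fun _ => b) ↔ ∀ i j, Commute (b : A) (S.s p i j) := by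
  have hinj : Function.Injective fun m : Matrix (Fin (R.dim p)) (Fin (R.dim p)) α.fixed =>
      m.map (fun c : α.fixed => (c : A)) := Matrix.map_injective Subtype.val_injective
  have h1 := (S.nondeg p).2.1
  have h2 := S.mul_conjTranspose hcleft p
  rw [← hinj.eq_iff]
  simp only [hF.1 p b]
  rw [Matrix.diagonal_map (by simp)]
  have h3 : (S.s p)ᴴ * Matrix.diagonal (fun _ => (b : A)) * S.s p =
      Matrix.diagonal (fun _ => (b : A)) ↔
      Matrix.diagonal (fun _ => (b : A)) * S.s p = S.s p * Matrix.diagonal (fun _ => (b : A)) := by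
    constructor
    · intro h
      rw [← h, ← Matrix.mul_assoc, ← Matrix.mul_assoc, h2, Matrix.one_mul, h]
    · intro h
      rw [Matrix.mul_assoc, h, ← Matrix.mul_assoc, h1, Matrix.one_mul]
  refine h3.trans ⟨fun h i j => ?_, fun h => ?_⟩
  · simpa [Commute, SemiconjBy] using congrFun (congrFun h i) j
  · ext i j
    simpa using (h i j).eq

/-- The flip of `ω(p, q)` is `s_{q ⊗ p}⋆ (s_p)₁₃ (s_q)₁₂`, because the flip of `s_{p ⊗ q}` is
`s_{q ⊗ p}`. As the latter is unitary, the symmetry of `ω` at `(p, q)` says that the legs `(s_q)₁₂`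
and `(s_p)₁₃` commute. -/
theorem FactorPair.IsAssociatedWith.ω_eq_tensorFlip_iff {F : FactorPair R α.fixed}
    (hF : F.IsAssociatedWith S) (hcleft : α.IsCleft) (p q : Dual G) :
    F.ω q p = tensorFlip (F.ω p q) ↔ ∀ i j k l, Commute (S.s q i j) (S.s p k l) := by
  have hinj : Function.Injective fun m : Matrix (Fin (R.dim q) × Fin (R.dim p))
      (Fin (R.dim q) × Fin (R.dim p)) α.fixed =>
      m.map (fun c : α.fixed => (c : A)) := Matrix.map_injective Subtype.val_injective
  obtain ⟨D, hD⟩ := hF.2 p q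
  obtain ⟨D', hD'⟩ := hF.2 q p
  have hflip : (tensorFlip (F.ω p q)).map (fun c : α.fixed => (c : A)) =
      (S.extend D')ᴴ * (leg13 _ (S.s p) * leg12 _ (S.s q)) := by
    calc _ = tensorFlip ((F.ω p q).map (fun c : α.fixed => (c : A))) := rfl
      _ = (tensorFlip (S.extend D))ᴴ * (leg13 _ (S.s p) * leg12 _ (S.s q)) := by
        rw [hD, tensorFlip_mul, tensorFlip_mul, tensorFlip_leg12, tensorFlip_leg13,
          Matrix.mul_assoc]
        rfl
      _ = _ := by rw [← S.extend_flip, S.extend_eq_extend D.flip D']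
  rw [← hinj.eq_iff, ← leg12_mul_leg13_eq_iff]
  simp only [hD', hflip]
  rw [Matrix.mul_assoc]
  refine ⟨fun h => ?_, fun h => by rw [h]⟩
  have h2 := congrArg (fun m => S.extend D' * m) h
  simpa only [← Matrix.mul_assoc, S.extend_mul_conjTranspose hcleft, Matrix.one_mul] using h2

end Family

/-! ### Generators of the algebra -/

section Generation

variable {G A : Type*} [Group G] [TopologicalSpace G] [CStarAlgebra A] {α : CStarSystem G A}

/-- For `x, y ∈ A₂(π)` the entries of `x⋆y` are fixed, since the factors `π_g` cancel. -/
theorem CStarSystem.conjTranspose_mul_apply_mem_fixed {ι : Type} [Fintype ι] [DecidableEq ι]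
    {π : URep G ι} {x y : Matrix ι ι A} (hx : x ∈ α.A₂ π) (hy : y ∈ α.A₂ π) (i j : ι) :
    (xᴴ * y) i j ∈ α.fixed := by
  intro g
  have h : xᴴ * y = (x.map (α.act g))ᴴ * y.map (α.act g) := by
    conv_lhs => rw [← hx g, ← hy g]
    rw [Matrix.conjTranspose_mul, Matrix.mul_assoc, ← Matrix.mul_assoc _ᴴ (scal A _),
      ← scal_conjTranspose, ← scal_mul, π.conjTranspose_mul_mat, scal_one, Matrix.one_mul]
  conv_rhs => rw [h]
  simp [Matrix.mul_apply, map_star]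

theorem matrix_mul_apply_mem {R A ι κ ν : Type*} [CommSemiring R] [Semiring A] [Algebra R A]
    [Fintype κ] {T : Subalgebra R A} {x : Matrix ι κ A} {y : Matrix κ ν A}
    (hx : ∀ i j, x i j ∈ T) (hy : ∀ i j, y i j ∈ T) (i : ι) (j : ν) : (x * y) i j ∈ T :=
  T.sum_mem fun _ _ => T.mul_mem (hx _ _) (hy _ _)

/-- The entries of every element of `A₂(π)` lie in the algebra generated by the fixed point algebra
and the entries of the `s_p`: for a representative `p` an element `X` of `A₂(p)` is `s_p (s_p⋆ X)`,
where `s_p⋆ X` has fixed entries, and any other `π` is conjugated to its representative. -/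
theorem CStarSystem.IsometryFamily.apply_mem_adjoin {R : Representatives G}
    (S : α.IsometryFamily R) {π : Irrep G} {x : Matrix (Fin π.dim) (Fin π.dim) A}
    (hx : x ∈ α.A₂ π.rep) (i j : Fin π.dim) :
    x i j ∈ Algebra.adjoin ℂ ((α.fixed : Set A) ∪ {a | ∃ p i j, S.s p i j = a}) := by
  set T := Algebra.adjoin ℂ ((α.fixed : Set A) ∪ {a | ∃ p i j, S.s p i j = a})
  have hscal : ∀ {ι κ : Type} (m : Matrix ι κ ℂ) (i : ι) (j : κ), scal A m i j ∈ T :=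
    fun m i j => T.algebraMap_mem _
  let p : Dual G := Quotient.mk (irrepSetoid G) π
  obtain ⟨v, hv1, -, hv⟩ : Irrep.Equivalent G π (R.irrep p) := Quotient.exact (R.spec p).symm
  have hX : scal A v * x * scal A vᴴ ∈ α.A₂ (R.rep p) := by
    intro g
    have h1 : (scal A v * x * scal A vᴴ).map (α.act g) =
        scal A v * x.map (α.act g) * scal A vᴴ := by
      have h2 : ∀ {ι κ : Type} (m : Matrix ι κ ℂ), (scal A m).map (α.act g) = scal A m :=
        fun m => by
          ext i j
          simp [scal, Algebra.algebraMap_eq_smul_one]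
      rw [Matrix.map_mul, Matrix.map_mul, h2, h2]
    rw [h1, ← Matrix.mul_assoc, ← Matrix.mul_assoc, ← scal_mul, ← hv g, scal_mul,
      Matrix.mul_assoc (scal A v), hx g]
  have hXT : ∀ i j, (scal A v * x * scal A vᴴ) i j ∈ T := by
    rw [← (S.nondeg p).2.2 _ hX, Matrix.mul_assoc]
    exact matrix_mul_apply_mem (fun i j => Algebra.subset_adjoin (Or.inr ⟨p, i, j, rfl⟩))
      fun i j => Algebra.subset_adjoin
        (Or.inl (conjTranspose_mul_apply_mem_fixed (S.nondeg p).1 hX i j))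
  have hx_eq : x = scal A vᴴ * (scal A v * x * scal A vᴴ) * scal A v := by
    have h : scal A vᴴ * scal A v = 1 := by rw [← scal_mul, hv1, scal_one]
    simp only [Matrix.mul_assoc, h, Matrix.mul_one]
    rw [← Matrix.mul_assoc, h, Matrix.one_mul]
  rw [hx_eq]
  exact matrix_mul_apply_mem (matrix_mul_apply_mem (hscal _) hXT) (hscal _) i j

theorem CStarSystem.IsometryFamily.topologicalClosure_adjoin [IsTopologicalGroup G]
    [CompactSpace G] {R : Representatives G} (S : α.IsometryFamily R) :
    (Algebra.adjoin ℂ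
      ((α.fixed : Set A) ∪ {a | ∃ p i j, S.s p i j = a})).topologicalClosure = ⊤ := by
  rw [eq_top_iff]
  intro x _
  have hx : x ∈ (⊤ : Submodule ℂ A) := trivial
  rw [← α.topologicalClosure_span_entries] at hx
  change x ∈ closure _
  refine closure_mono (Submodule.span_le (p := Subalgebra.toSubmodule (Algebra.adjoin ℂ
    ((α.fixed : Set A) ∪ {a | ∃ p i j, S.s p i j = a}))).2 ?_) hx
  rintro _ ⟨π, x, hx, i, j, rfl⟩
  exact S.apply_mem_adjoin hx i j

end Generation

end CleftSystem

theorem commute_of_topologicalClosure_adjoin_eq_top {A : Type*} [CStarAlgebra A] {C : Set A}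
    (hC : (Algebra.adjoin ℂ C).topologicalClosure = ⊤) (hcomm : ∀ a ∈ C, ∀ b ∈ C, Commute a b)
    (x y : A) : Commute x y := by
  have hmem : ∀ z : A, z ∈ C.centralizer.centralizer := fun z => by
    have hz : z ∈ (Algebra.adjoin ℂ C).topologicalClosure := hC ▸ Algebra.mem_top
    exact closure_minimal (Algebra.adjoin_le_centralizer_centralizer ℂ C)
      (Set.isClosed_centralizer _) hz
  have hsub : C.centralizer.centralizer ⊆ C.centralizer :=
    Set.centralizer_subset fun a ha b hb => hcomm b hb a ha
  exact hmem y x (hsub (hmem x))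

theorem mainTheorem4
    {G : Type*} [Group G] [TopologicalSpace G] [IsTopologicalGroup G] [CompactSpace G] [T2Space G]
    {A : Type*} [CStarAlgebra A]
    (α : CleftSystem.CStarSystem G A) (hcleft : α.IsCleft)
    (hB : ∀ b c : α.fixed, b * c = c * b)
    (R : CleftSystem.Representatives G)
    (S : α.IsometryFamily R)
    (F : CleftSystem.FactorPair R α.fixed) (hF : F.IsAssociatedWith S) :
    (∀ x y : A, x * y = y * x) ↔
      ((∀ (p : CleftSystem.Dual G) (b : α.fixed), F.γ p b = Matrix.diagonal (fun _ => b)) ∧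
        ∀ p q : CleftSystem.Dual G, F.ω q p = CleftSystem.tensorFlip (F.ω p q)) := by
  simp only [hF.γ_eq_diagonal_iff S hcleft, hF.ω_eq_tensorFlip_iff S hcleft]
  refine ⟨fun h => ⟨fun p b i j => h _ _, fun p q i j k l => h _ _⟩, fun ⟨hγ, hω⟩ x y => ?_⟩
  refine commute_of_topologicalClosure_adjoin_eq_top S.topologicalClosure_adjoin ?_ x y
  rintro a (ha | ⟨p, i, j, rfl⟩) b (hb | ⟨q, k, l, rfl⟩)
  · exact congrArg Subtype.val (hB ⟨a, ha⟩ ⟨b, hb⟩)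
  · exact hγ q ⟨a, ha⟩ k l
  · exact (hγ p ⟨b, hb⟩ i j).symm
  · exact hω q p i j k l
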